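/- Theorem. Let $R$ be a nonzero associative unital ring and let $\mathfrak{i}$ be a proper (two-sided) ideal of $R$ such that $R$ is separated and complete in the $\mathfrak{i}$-adic topology and such that the associated graded ring $\operatorname{gr} R = R/\mathfrak{i} \oplus \mathfrak{i}/\mathfrak{i}^2 \oplus \mathfrak{i}^2/\mathfrak{i}^3 \oplus \cdots$ is (left and right) noetherian. Let $\tau$ be a ring automorphism of $R$ with $\tau(\mathfrak{i}) = \mathfrak{i}$, and let $\delta$ be a left $\tau$-derivation of $R$, that is, an additive map with $\delta(ab) = \tau(a)\delta(b) + \delta(a)b$ for all $a,b \in R$; assume $\delta(R) \subseteq \mathfrak{i}$ and $\delta(\mathfrak{i}) \subseteq \mathfrak{i}^2$. Let $T = R[[y;\tau,\delta]]$ be the skew power series ring: its elements are the formal series $\sum_{n \ge 0} a_n y^n$ with $a_n \in R$, and its multiplication is determined by $yr = \tau(r)y + \delta(r)$ for $r \in R$, the coefficients of a product being convergent series in the $\mathfrak{i}$-adic topology. Let $S = R[y;\tau,\delta] \subseteq T$ be the skew polynomial subring, consisting of the series with only finitely many nonzero coefficients. Assume that $\tau$ extends to an automorphism of $T$ that restricts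 to an automorphism of $S$; fix such an extension and denote it again by $\tau$. For a ring $A$ with an automorphism $\alpha$, an $\alpha$-ideal is a two-sided ideal $I$ with $\alpha(I) \subseteq I$; a proper $\alpha$-ideal $P$ of $A$ is $\alpha$-prime if the product of any two nonzero $\alpha$-ideals of $A/P$ (under the induced action of $\alpha$) is nonzero. A $\tau$-$\delta$-ideal of $R$ is a two-sided ideal $I$ with $\tau(I) = I$ and $\delta(I) \subseteq I$; a proper $\tau$-$\delta$-ideal $Q$ of $R$ is $\tau$-$\delta$-prime if the product of any two nonzero $\tau$-$\delta$-ideals of $R/Q$ (under the induced actions of $\tau$ and $\delta$) is nonzero. (i) (Lying over) For every $\tau$-$\delta$-prime ideal $Q$ of $R$ there exists a $\tau$-prime ideal $P$ of $T$ with $P \cap R = Q$. (ii) (Cutting down) For every $\tau$-prime ideal $P$ of $T$, the contraction $P \cap R$ is a $\tau$-$\delta$-prime ideal of $R$. -/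

import Mathlib

open scoped DirectSum

/-! ### The associated graded ring of an `I`-adic filtration -/

/-- The `n`-th homogeneous component `I ^ n / I ^ (n + 1)`. -/
abbrev GrPiece {R : Type*} [Ring R] (I : Ideal R) (n : ℕ) : Type _ :=
  ↥(I ^ n) ⧸ Submodule.comap (I ^ n).subtype (I ^ (n + 1))

namespace GrPiece

variable {R : Type*} [Ring R] (I : Ideal R)

/-- The class `a + I ^ (n + 1)` of an element `a ∈ I ^ n`. -/
def mk (n : ℕ) (a : R) (ha : a ∈ I ^ n) : GrPiece I n :=
  Submodule.Quotient.mk ⟨a, ha⟩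

theorem mk_eq_mk {n : ℕ} {a b : R} (ha : a ∈ I ^ n) (hb : b ∈ I ^ n) :
    mk I n a ha = mk I n b hb ↔ a - b ∈ I ^ (n + 1) :=
  Submodule.Quotient.eq _

theorem exists_mk {n : ℕ} (x : GrPiece I n) : ∃ a ha, x = mk I n a ha := by
  obtain ⟨⟨a, ha⟩, rfl⟩ := Submodule.Quotient.mk_surjective _ x
  exact ⟨a, ha, rfl⟩

theorem mk_add {n : ℕ} {a b : R} (ha : a ∈ I ^ n) (hb : b ∈ I ^ n) :
    mk I n a ha + mk I n b hb = mk I n (a + b) (add_mem ha hb) := rfl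

theorem mk_zero {n : ℕ} : mk I n 0 (zero_mem _) = 0 := rfl

theorem graded_ext {m n : ℕ} {a b : R} (ha : a ∈ I ^ m) (hb : b ∈ I ^ n)
    (hmn : m = n) (hab : a = b) :
    (GradedMonoid.mk m (mk I m a ha) : GradedMonoid (GrPiece I)) =
      GradedMonoid.mk n (mk I n b hb) := by
  subst hmn; subst hab; rfl

theorem mem_pow_zero (a : R) : a ∈ I ^ 0 := by
  rw [Submodule.pow_zero, Ideal.one_eq_top]; trivial

variable [I.IsTwoSided]

theorem mul_mem_pow {m n : ℕ} {a b : R} (ha : a ∈ I ^ m) (hb : b ∈ I ^ n) :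
    a * b ∈ I ^ (m + n) := by
  rw [Ideal.IsTwoSided.pow_add]
  exact Ideal.mul_mem_mul ha hb

/-- The multiplication `(a + I ^ (m + 1)) (b + I ^ (n + 1)) = a b + I ^ (m + n + 1)`. -/
def mul {m n : ℕ} (x : GrPiece I m) (y : GrPiece I n) : GrPiece I (m + n) :=
  Quotient.liftOn₂' x y (fun a b => mk I (m + n) (a.1 * b.1) (mul_mem_pow I a.2 b.2))
    (by
      intro a b a' b' h h'
      have h1 : a.1 - a'.1 ∈ I ^ (m + 1) := by
        simpa using (Submodule.quotientRel_def _).1 h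
      have h2 : b.1 - b'.1 ∈ I ^ (n + 1) := by
        simpa using (Submodule.quotientRel_def _).1 h'
      rw [mk_eq_mk]
      have e : a.1 * b.1 - a'.1 * b'.1 = a.1 * (b.1 - b'.1) + (a.1 - a'.1) * b'.1 := by
        noncomm_ring
      rw [e]
      refine add_mem (mul_mem_pow I (m := m) (n := n + 1) a.2 h2) ?_
      have := mul_mem_pow I h1 b'.2
      rwa [show m + 1 + n = m + n + 1 by omega] at this)

theorem mul_mk {m n : ℕ} {a b : R} (ha : a ∈ I ^ m) (hb : b ∈ I ^ n) :
    mul I (mk I m a ha) (mk I n b hb) = mk I (m + n) (a * b) (mul_mem_pow I ha hb) := rfl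

instance : GradedMonoid.GMul (GrPiece I) := ⟨mul I⟩

instance : GradedMonoid.GOne (GrPiece I) := ⟨mk I 0 1 (mem_pow_zero I 1)⟩

instance : GradedMonoid.GMonoid (GrPiece I) where
  one_mul := by
    rintro ⟨n, x⟩
    obtain ⟨a, ha, rfl⟩ := exists_mk I x
    exact graded_ext I _ _ (zero_add n) (one_mul a)
  mul_one := by
    rintro ⟨n, x⟩
    obtain ⟨a, ha, rfl⟩ := exists_mk I x
    exact graded_ext I _ _ (add_zero n) (mul_one a)
  mul_assoc := by
    rintro ⟨l, x⟩ ⟨m, y⟩ ⟨n, z⟩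
    obtain ⟨a, ha, rfl⟩ := exists_mk I x
    obtain ⟨b, hb, rfl⟩ := exists_mk I y
    obtain ⟨c, hc, rfl⟩ := exists_mk I z
    exact graded_ext I _ _ (add_assoc l m n) (mul_assoc a b c)

instance : DirectSum.GRing (GrPiece I) where
  mul_zero {m n} x := by
    obtain ⟨a, ha, rfl⟩ := exists_mk I x
    exact (mk_eq_mk I _ (zero_mem _)).2 (by simp)
  zero_mul {m n} x := by
    obtain ⟨a, ha, rfl⟩ := exists_mk I x
    exact (mk_eq_mk I _ (zero_mem _)).2 (by simp)
  mul_add {m n} x y z := by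
    obtain ⟨a, ha, rfl⟩ := exists_mk I x
    obtain ⟨b, hb, rfl⟩ := exists_mk I y
    obtain ⟨c, hc, rfl⟩ := exists_mk I z
    exact (mk_eq_mk I _ (add_mem (mul_mem_pow I ha hb) (mul_mem_pow I ha hc))).2
      (by simp [mul_add])
  add_mul {m n} x y z := by
    obtain ⟨a, ha, rfl⟩ := exists_mk I x
    obtain ⟨b, hb, rfl⟩ := exists_mk I y
    obtain ⟨c, hc, rfl⟩ := exists_mk I z
    exact (mk_eq_mk I _ (add_mem (mul_mem_pow I ha hc) (mul_mem_pow I hb hc))).2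
      (by simp [add_mul])
  natCast n := mk I 0 (n : R) (mem_pow_zero I _)
  natCast_zero := by rw [← mk_zero, mk_eq_mk]; simp
  natCast_succ n := by
    refine Eq.trans ?_ (mk_add I _ _).symm
    rw [mk_eq_mk]; simp
  intCast n := mk I 0 (n : R) (mem_pow_zero I _)
  intCast_ofNat n := by rw [mk_eq_mk]; simp
  intCast_negSucc_ofNat n := by
    refine Eq.trans ?_ (Submodule.Quotient.mk_neg _)
    exact (mk_eq_mk I _ (neg_mem (mem_pow_zero I _))).2 (by simp)

end GrPiece

/-- The associated graded ring `gr R = R / I ⊕ I / I ^ 2 ⊕ I ^ 2 / I ^ 3 ⊕ ⋯` of the `I`-adic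
filtration, for a two-sided ideal `I` of a (not necessarily commutative) ring `R`. -/
abbrev AssocGraded {R : Type*} [Ring R] (I : Ideal R) : Type _ := ⨁ n, GrPiece I n

/-- A ring is noetherian if it is both left and right noetherian. -/
def IsTwoSidedNoetherian (A : Type*) [Ring A] : Prop :=
  IsNoetherianRing A ∧ IsNoetherianRing Aᵐᵒᵖ

/-! ### Convergence in the `I`-adic topology -/

/-- The sequence `f` is Cauchy in the `I`-adic topology. -/
def IsAdicCauchy {R : Type*} [Ring R] (I : Ideal R) (f : ℕ → R) : Prop :=
  ∀ k, ∃ N, ∀ m ≥ N, ∀ n ≥ N, f m - f n ∈ I ^ k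

/-- The sequence `f` converges to `L` in the `I`-adic topology. -/
def AdicTendsto {R : Type*} [Ring R] (I : Ideal R) (f : ℕ → R) (L : R) : Prop :=
  ∀ k, ∃ N, ∀ n ≥ N, f n - L ∈ I ^ k

open Classical in
/-- The sum `∑ f i` of a series that converges in the `I`-adic topology (and `0` if the series
diverges). -/
noncomputable def adicSum {R : Type*} [Ring R] (I : Ideal R) (f : ℕ → R) : R :=
  if h : ∃ L, AdicTendsto I (fun n => ∑ i ∈ Finset.range n, f i) L then h.choose else 0

/-! ### The coefficient data of a skew power series ring -/

/-- An ideal `i`, an automorphism `τ` and a left `τ`-derivation `δ` of `R`, such that `R` is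
separated and complete in the `i`-adic topology, `τ(i) = i`, `δ(R) ⊆ i` and `δ(i) ⊆ i ^ 2`. -/
structure SkewDatum (R : Type*) [Ring R] where
  /-- the ideal that defines the topology -/
  i : Ideal R
  i_twoSided : i.IsTwoSided
  i_ne_top : i ≠ ⊤
  separated : ⨅ n : ℕ, i ^ n = ⊥
  complete : ∀ f : ℕ → R, IsAdicCauchy i f → ∃ L, AdicTendsto i f L
  /-- the automorphism -/
  τ : R ≃+* R
  /-- the left `τ`-derivation -/
  δ : R →+ R
  δ_mul : ∀ a b, δ (a * b) = τ a * δ b + δ a * b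
  τ_image : τ '' (i : Set R) = i
  δ_mem : ∀ r, δ r ∈ i
  δ_mem_sq : ∀ r ∈ i, δ r ∈ i ^ 2

attribute [instance] SkewDatum.i_twoSided

namespace SkewDatum

variable {R : Type*} [Ring R] (D : SkewDatum R)

theorem τ_mem_pow (k : ℕ) : ∀ {r : R}, r ∈ D.i ^ k → D.τ r ∈ D.i ^ k := by
  induction k with
  | zero => intro r _; exact GrPiece.mem_pow_zero _ _
  | succ k ih =>
    intro r hr
    rw [Ideal.IsTwoSided.pow_succ] at hr ⊢
    refine Submodule.mul_induction_on hr ?_ ?_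
    · intro a ha b hb
      rw [map_mul]
      refine Ideal.mul_mem_mul ?_ (ih hb)
      have : D.τ a ∈ D.τ '' (D.i : Set R) := ⟨a, ha, rfl⟩
      rwa [D.τ_image] at this
    · intro a b ha hb
      rw [map_add]; exact add_mem ha hb

theorem δ_mem_pow (k : ℕ) : ∀ {r : R}, r ∈ D.i ^ k → D.δ r ∈ D.i ^ (k + 1) := by
  induction k with
  | zero => intro r _; simpa [Submodule.pow_one] using D.δ_mem r
  | succ k ih =>
    intro r hr
    rw [Ideal.IsTwoSided.pow_succ] at hr
    refine Submodule.mul_induction_on hr ?_ ?_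
    · intro a ha b hb
      rw [D.δ_mul]
      refine add_mem ?_ ?_
      · have h1 : D.τ a ∈ D.i ^ 1 := D.τ_mem_pow 1 (by simpa [Submodule.pow_one] using ha)
        have := GrPiece.mul_mem_pow D.i h1 (ih hb)
        rwa [show 1 + (k + 1) = k + 1 + 1 by omega] at this
      · have := GrPiece.mul_mem_pow D.i (D.δ_mem_sq a ha) hb
        rwa [show 2 + k = k + 1 + 1 by omega] at this
    · intro a b ha hb
      rw [map_add]; exact add_mem ha hb

theorem eq_of_sub_mem {a b : R} (h : ∀ k, a - b ∈ D.i ^ k) : a = b := by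
  have : a - b ∈ ⨅ n : ℕ, D.i ^ n := (Submodule.mem_iInf _).2 h
  rw [D.separated] at this
  exact sub_eq_zero.1 ((Submodule.mem_bot R).1 this)

theorem sum_range_sub_mem {f : ℕ → R} {n : ℕ} (hf : ∀ i, f i ∈ D.i ^ (i - n)) {N M : ℕ}
    (h : N ≤ M) :
    ∑ i ∈ Finset.range M, f i - ∑ i ∈ Finset.range N, f i ∈ D.i ^ (N - n) := by
  rw [← Finset.sum_Ico_eq_sub _ h]
  refine sum_mem fun i hi => Ideal.pow_le_pow_right ?_ (hf i)
  have := (Finset.mem_Ico.1 hi).1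
  omega

theorem adicSum_sub_mem {f : ℕ → R} {n : ℕ} (hf : ∀ i, f i ∈ D.i ^ (i - n)) (N : ℕ) :
    adicSum D.i f - ∑ i ∈ Finset.range N, f i ∈ D.i ^ (N - n) := by
  have h : ∃ L, AdicTendsto D.i (fun n => ∑ i ∈ Finset.range n, f i) L := by
    refine D.complete _ fun k => ⟨k + n, fun m hm l hl => ?_⟩
    have h1 := D.sum_range_sub_mem hf hm
    have h2 := D.sum_range_sub_mem hf hl
    have := sub_mem h1 h2
    simpa using this
  have hs : adicSum D.i f = h.choose := by rw [adicSum, dif_pos h]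
  rw [hs]
  obtain ⟨M, hM⟩ := h.choose_spec (N - n)
  have h1 := hM (max M N) (le_max_left _ _)
  have h2 := D.sum_range_sub_mem hf (le_max_right M N)
  have := sub_mem h2 h1
  simpa using this

theorem eq_adicSum {f : ℕ → R} {n : ℕ} (hf : ∀ i, f i ∈ D.i ^ (i - n)) {x : R}
    (hx : ∀ N, x - ∑ i ∈ Finset.range N, f i ∈ D.i ^ (N - n)) : x = adicSum D.i f := by
  refine D.eq_of_sub_mem fun k => ?_
  have h1 := hx (k + n)
  have h2 := D.adicSum_sub_mem hf (k + n)
  have := sub_mem h1 h2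
  simpa using this

/-! ### The skew power series ring -/

/-- The underlying set of `R[[y; τ, δ]]`: the series `∑ aₙ yⁿ` with coefficients on the left,
encoded as the sequence of their coefficients. -/
def PowerSeries (_ : SkewDatum R) : Type _ := ℕ → R

namespace PowerSeries

variable {D}

instance : AddCommGroup D.PowerSeries := inferInstanceAs (AddCommGroup (ℕ → R))

/-- The coefficient `aₙ` of `yⁿ` in `∑ aₙ yⁿ`. -/
def coeff (n : ℕ) (a : D.PowerSeries) : R := a n

/-- The series with given coefficients. -/
def mk (f : ℕ → R) : D.PowerSeries := f

@[simp] theorem coeff_mk (f : ℕ → R) (n : ℕ) : coeff n (mk f : D.PowerSeries) = f n := rfl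

@[ext] theorem ext {a b : D.PowerSeries} (h : ∀ n, coeff n a = coeff n b) : a = b := funext h

@[simp] theorem coeff_add (n : ℕ) (a b : D.PowerSeries) :
    coeff n (a + b) = coeff n a + coeff n b := rfl

@[simp] theorem coeff_zero (n : ℕ) : coeff n (0 : D.PowerSeries) = 0 := rfl

/-- Left multiplication by `y`, as dictated by `y r = τ(r) y + δ(r)`:
`y (∑ bₙ yⁿ) = ∑ (τ(bₙ) yⁿ⁺¹ + δ(bₙ) yⁿ)`. -/
def yMul (b : D.PowerSeries) : D.PowerSeries :=
  mk fun n => (if n = 0 then 0 else D.τ (coeff (n - 1) b)) + D.δ (coeff n b)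

/-- `yPowMul i b` is `yⁱ b`; its `n`-th coefficient is `∑_{j ≤ n} θ_{i, n - j}(b_j)`, where
`yⁱ r = ∑_k θ_{i, k}(r) yᵏ`. -/
def yPowMul (i : ℕ) (b : D.PowerSeries) : D.PowerSeries := yMul^[i] b

/-- Multiplication: `(∑ aᵢ yⁱ) b = ∑ aᵢ (yⁱ b)`, each coefficient being a convergent series in
the `i`-adic topology of `R`. -/
noncomputable instance : Mul D.PowerSeries where
  mul a b := mk fun n => adicSum D.i fun i => coeff i a * coeff n (yPowMul i b)

/-- The constant series `r`. -/
def const (r : R) : D.PowerSeries := mk fun n => if n = 0 then r else 0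

instance : One D.PowerSeries := ⟨const 1⟩

theorem coeff_mul (n : ℕ) (a b : D.PowerSeries) :
    coeff n (a * b) = adicSum D.i fun i => coeff i a * coeff n (yPowMul i b) := rfl

theorem coeff_yMul (n : ℕ) (b : D.PowerSeries) : coeff n (yMul b) =
    (if n = 0 then 0 else D.τ (coeff (n - 1) b)) + D.δ (coeff n b) := rfl

theorem coeff_const (n : ℕ) (r : R) :
    coeff n (const r : D.PowerSeries) = if n = 0 then r else 0 := rfl

theorem coeff_one (n : ℕ) : coeff n (1 : D.PowerSeries) = if n = 0 then 1 else 0 := rfl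

theorem yPowMul_zero (b : D.PowerSeries) : yPowMul 0 b = b := rfl

theorem yPowMul_succ (i : ℕ) (b : D.PowerSeries) :
    yPowMul (i + 1) b = yMul (yPowMul i b) := Function.iterate_succ_apply' _ _ _

theorem yPowMul_add_right (i : ℕ) (b c : D.PowerSeries) :
    yPowMul i (b + c) = yPowMul i b + yPowMul i c := by
  induction i with
  | zero => rfl
  | succ i ih =>
    rw [yPowMul_succ, yPowMul_succ, yPowMul_succ, ih]
    ext n
    simp only [coeff_yMul, coeff_add, map_add]
    split_ifs
    · abel
    · abel

theorem coeff_yPowMul_mem (i : ℕ) (b : D.PowerSeries) :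
    ∀ n, coeff n (yPowMul i b) ∈ D.i ^ (i - n) := by
  induction i with
  | zero => intro n; rw [Nat.zero_sub]; exact GrPiece.mem_pow_zero _ _
  | succ i ih =>
    intro n
    rw [yPowMul_succ, coeff_yMul]
    refine add_mem ?_ ?_
    · split_ifs with h
      · exact zero_mem _
      · have := D.τ_mem_pow _ (ih (n - 1))
        exact Ideal.pow_le_pow_right (by omega) this
    · have := D.δ_mem_pow _ (ih n)
      exact Ideal.pow_le_pow_right (by omega) this

theorem mul_term_mem (a b : D.PowerSeries) (n i : ℕ) :
    coeff i a * coeff n (yPowMul i b) ∈ D.i ^ (i - n) :=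
  Ideal.mul_mem_left _ _ (coeff_yPowMul_mem i b n)

theorem coeff_mul_sub_mem (a b : D.PowerSeries) (n N : ℕ) :
    coeff n (a * b) - ∑ i ∈ Finset.range N, coeff i a * coeff n (yPowMul i b)
      ∈ D.i ^ (N - n) :=
  D.adicSum_sub_mem (mul_term_mem a b n) N

theorem eq_coeff_mul {a b : D.PowerSeries} {n : ℕ} {x : R}
    (hx : ∀ N, x - ∑ i ∈ Finset.range N, coeff i a * coeff n (yPowMul i b)
      ∈ D.i ^ (N - n)) : x = coeff n (a * b) :=
  D.eq_adicSum (mul_term_mem a b n) hx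

protected theorem left_distrib (a b c : D.PowerSeries) : a * (b + c) = a * b + a * c := by
  ext n
  refine (eq_coeff_mul fun N => ?_).symm
  have := add_mem (coeff_mul_sub_mem a b n N) (coeff_mul_sub_mem a c n N)
  convert this using 1
  simp only [coeff_add, yPowMul_add_right, mul_add, Finset.sum_add_distrib]
  abel

protected theorem right_distrib (a b c : D.PowerSeries) : (a + b) * c = a * c + b * c := by
  ext n
  refine (eq_coeff_mul fun N => ?_).symm
  have := add_mem (coeff_mul_sub_mem a c n N) (coeff_mul_sub_mem b c n N)
  convert this using 1
  simp only [coeff_add, add_mul, Finset.sum_add_distrib]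
  abel

theorem coeff_const_mul (r : R) (b : D.PowerSeries) (n : ℕ) :
    coeff n (const r * b) = r * coeff n b := by
  refine (eq_coeff_mul fun N => ?_).symm
  rcases Nat.eq_zero_or_pos N with rfl | hN
  · rw [Nat.zero_sub]; exact GrPiece.mem_pow_zero _ _
  · rw [Finset.sum_eq_single_of_mem 0 (Finset.mem_range.2 hN)]
    · simp [coeff_const, yPowMul_zero]
    · intro i _ hi
      simp [coeff_const, hi]

protected theorem one_mul (b : D.PowerSeries) : 1 * b = b := by
  ext n
  exact (coeff_const_mul 1 b n).trans (one_mul _)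

theorem δ_one : D.δ 1 = 0 := by
  have := D.δ_mul 1 1
  simpa using this

theorem coeff_yPowMul_one (i n : ℕ) :
    coeff n (yPowMul i (1 : D.PowerSeries)) = if n = i then 1 else 0 := by
  induction i generalizing n with
  | zero => exact coeff_one n
  | succ i ih =>
    rw [yPowMul_succ, coeff_yMul, ih, ih]
    rcases Nat.eq_zero_or_pos n with rfl | hn
    · by_cases h : 0 = i
      · subst h; simp [δ_one]
      · simp [h]
    · by_cases h : n - 1 = i
      · have h1 : n = i + 1 := by omega
        subst h1
        simp
      · have h1 : n ≠ i + 1 := by omega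
        by_cases h2 : n = i
        · subst h2
          simp [hn.ne', h, δ_one]
        · simp [h, h1, h2]

protected theorem mul_one (a : D.PowerSeries) : a * 1 = a := by
  ext n
  refine (eq_coeff_mul fun N => ?_).symm
  simp only [coeff_yPowMul_one, mul_ite, mul_one, mul_zero]
  by_cases h : n < N
  · simp [h]
  · rw [show N - n = 0 by omega]; exact GrPiece.mem_pow_zero _ _

theorem yMul_mul (a b : D.PowerSeries) : yMul a * b = yMul (a * b) := by
  ext n
  refine (eq_coeff_mul fun N => ?_).symm
  rcases N with _ | N
  · rw [Nat.zero_sub]; exact GrPiece.mem_pow_zero _ _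
  -- the `τ`-part of the sum is shifted by one index
  have key : ∑ i ∈ Finset.range (N + 1), coeff i (yMul a) * coeff n (yPowMul i b) =
      (if n = 0 then 0 else
        D.τ (∑ i ∈ Finset.range N, coeff i a * coeff (n - 1) (yPowMul i b))) +
      D.δ (∑ i ∈ Finset.range N, coeff i a * coeff n (yPowMul i b)) +
      D.δ (coeff N a) * coeff n (yPowMul N b) := by
    have e1 : ∑ i ∈ Finset.range (N + 1), coeff i (yMul a) * coeff n (yPowMul i b) =
        ∑ i ∈ Finset.range N, D.τ (coeff i a) * coeff n (yPowMul (i + 1) b) +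
        ∑ i ∈ Finset.range (N + 1), D.δ (coeff i a) * coeff n (yPowMul i b) := by
      simp only [coeff_yMul, add_mul, Finset.sum_add_distrib]
      congr 1
      rw [Finset.sum_range_succ']
      simp
    rw [e1, Finset.sum_range_succ, ← add_assoc]
    congr 1
    rw [map_sum D.δ]
    simp only [D.δ_mul, yPowMul_succ, coeff_yMul, mul_add, Finset.sum_add_distrib]
    split_ifs with h
    · simp
    · simp only [map_sum, map_mul]
      abel
  rw [key, coeff_yMul]
  have h2 := D.δ_mem_pow _ (coeff_mul_sub_mem a b n N)
  rw [map_sub] at h2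
  have h3 : D.δ (coeff N a) * coeff n (yPowMul N b) ∈ D.i ^ (N + 1 - n) := by
    have := GrPiece.mul_mem_pow D.i (m := 1) (by simpa [Submodule.pow_one] using D.δ_mem (coeff N a))
      (coeff_yPowMul_mem N b n)
    exact Ideal.pow_le_pow_right (by omega) this
  have h2' := Ideal.pow_le_pow_right (I := D.i) (show N + 1 - n ≤ N - n + 1 by omega) h2
  split_ifs with h
  · have := sub_mem h2' h3
    convert this using 1
    abel
  · have h1 := D.τ_mem_pow _ (coeff_mul_sub_mem a b (n - 1) N)
    rw [map_sub, show N - (n - 1) = N + 1 - n by omega] at h1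
    have := sub_mem (add_mem h1 h2') h3
    convert this using 1
    abel

theorem yPowMul_mul (i : ℕ) (a b : D.PowerSeries) : yPowMul i a * b = yPowMul i (a * b) := by
  induction i with
  | zero => rfl
  | succ i ih => rw [yPowMul_succ, yPowMul_succ, yMul_mul, ih]

protected theorem mul_assoc (a b c : D.PowerSeries) : a * b * c = a * (b * c) := by
  ext n
  refine D.eq_of_sub_mem fun k => ?_
  set M := n + k with hM
  set L := n + k + k with hL
  have h1 := coeff_mul_sub_mem (a * b) c n M
  have h2 := coeff_mul_sub_mem a (b * c) n L
  have h3 : ∑ i ∈ Finset.range M, coeff i (a * b) * coeff n (yPowMul i c) -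
      ∑ i ∈ Finset.range M, (∑ l ∈ Finset.range L, coeff l a * coeff i (yPowMul l b)) *
        coeff n (yPowMul i c) ∈ D.i ^ k := by
    rw [← Finset.sum_sub_distrib]
    refine sum_mem fun i hi => ?_
    rw [← sub_mul]
    refine Ideal.mul_mem_right _ _ (Ideal.pow_le_pow_right ?_ (coeff_mul_sub_mem a b i L))
    have := Finset.mem_range.1 hi
    omega
  have h4 : ∑ l ∈ Finset.range L, coeff l a * coeff n (yPowMul l (b * c)) -
      ∑ l ∈ Finset.range L, coeff l a * ∑ i ∈ Finset.range M,
        coeff i (yPowMul l b) * coeff n (yPowMul i c) ∈ D.i ^ k := by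
    rw [← Finset.sum_sub_distrib]
    refine sum_mem fun l _ => ?_
    rw [← mul_sub, ← yPowMul_mul]
    refine Ideal.mul_mem_left _ _ (Ideal.pow_le_pow_right ?_ (coeff_mul_sub_mem _ c n M))
    omega
  have h5 : ∑ i ∈ Finset.range M, (∑ l ∈ Finset.range L, coeff l a * coeff i (yPowMul l b)) *
      coeff n (yPowMul i c) = ∑ l ∈ Finset.range L, coeff l a * ∑ i ∈ Finset.range M,
        coeff i (yPowMul l b) * coeff n (yPowMul i c) := by
    simp only [Finset.sum_mul, Finset.mul_sum, mul_assoc]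
    exact Finset.sum_comm
  have h1' := Ideal.pow_le_pow_right (I := D.i) (show k ≤ M - n by omega) h1
  have h2' := Ideal.pow_le_pow_right (I := D.i) (show k ≤ L - n by omega) h2
  have := sub_mem (add_mem h1' h3) (add_mem h2' h4)
  rw [h5] at this
  convert this using 1
  abel

/-- The skew power series ring `T = R[[y; τ, δ]]`. -/
noncomputable instance : Ring D.PowerSeries :=
  { (inferInstance : AddCommGroup D.PowerSeries),
    (inferInstance : Mul D.PowerSeries),
    (inferInstance : One D.PowerSeries) with
    left_distrib := PowerSeries.left_distrib
    right_distrib := PowerSeries.right_distrib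
    zero_mul := fun a => by
      have := PowerSeries.right_distrib 0 0 a
      rw [add_zero] at this
      exact left_eq_add.1 this
    mul_zero := fun a => by
      have := PowerSeries.left_distrib a 0 0
      rw [add_zero] at this
      exact left_eq_add.1 this
    mul_assoc := PowerSeries.mul_assoc
    one_mul := PowerSeries.one_mul
    mul_one := PowerSeries.mul_one }

/-- The inclusion of the coefficient ring `R` into `T`. -/
noncomputable def C : R →+* D.PowerSeries where
  toFun := const
  map_one' := rfl
  map_zero' := by ext n; simp [coeff_const]
  map_add' r s := by
    ext n
    simp only [coeff_const, coeff_add]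
    split_ifs
    · rfl
    · simp
  map_mul' r s := by
    ext n
    rw [coeff_const_mul, coeff_const, coeff_const]
    split_ifs
    · rfl
    · simp

theorem coeff_C (n : ℕ) (r : R) :
    coeff n (C r : D.PowerSeries) = if n = 0 then r else 0 := rfl

/-- The variable `y` of `T`. -/
def y : D.PowerSeries := mk fun n => if n = 1 then 1 else 0

theorem y_mul (b : D.PowerSeries) : y * b = yMul b := by
  have h : (y : D.PowerSeries) = yMul 1 := by
    ext n
    exact (coeff_yPowMul_one 1 n).symm
  rw [h, yMul_mul]
  exact congrArg yMul (one_mul b)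

theorem coeff_mul_y (b : D.PowerSeries) (n : ℕ) :
    coeff n (b * y) = if n = 0 then 0 else coeff (n - 1) b := by
  have h : ∀ i, yPowMul i (y : D.PowerSeries) = yPowMul (i + 1) 1 := by
    intro i
    induction i with
    | zero => rw [yPowMul_zero, yPowMul_succ, yPowMul_zero, ← y_mul, mul_one]
    | succ i ih => rw [yPowMul_succ, ih, ← yPowMul_succ]
  refine (eq_coeff_mul fun N => ?_).symm
  simp only [h, coeff_yPowMul_one, mul_ite, mul_one, mul_zero]
  rcases n with _ | n
  · simp
  · by_cases hN : n < N
    · simp [hN]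
    · rw [show N - (n + 1) = 0 by omega]; exact GrPiece.mem_pow_zero _ _

/-- The defining relation `y r = τ(r) y + δ(r)`. -/
theorem y_mul_C (r : R) :
    (y : D.PowerSeries) * C r = C (D.τ r) * y + C (D.δ r) := by
  ext n
  rw [y_mul, coeff_yMul, coeff_add, coeff_mul_y]
  simp only [coeff_C]
  rcases n with _ | _ | n <;> simp

/-- The skew polynomial ring `S = R[y; τ, δ]`: the subring of `T` of the series with only finitely
many nonzero coefficients. -/
noncomputable def skewPolynomials (D : SkewDatum R) : Subring D.PowerSeries where
  carrier := {a | ∃ N, ∀ n ≥ N, coeff n a = 0}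
  one_mem' := ⟨1, fun n hn => by rw [coeff_one, if_neg (by omega)]⟩
  zero_mem' := ⟨0, fun _ _ => rfl⟩
  add_mem' := by
    rintro a b ⟨N, hN⟩ ⟨M, hM⟩
    refine ⟨max N M, fun n hn => ?_⟩
    rw [coeff_add, hN n (le_trans (le_max_left _ _) hn), hM n (le_trans (le_max_right _ _) hn),
      add_zero]
  neg_mem' := by
    rintro a ⟨N, hN⟩
    refine ⟨N, fun n hn => ?_⟩
    have : coeff n (-a) = -coeff n a := rfl
    rw [this, hN n hn, neg_zero]
  mul_mem' := by
    rintro a b ⟨N, hN⟩ ⟨M, hM⟩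
    have h : ∀ i, ∀ n ≥ M + i, coeff n (yPowMul i b) = 0 := by
      intro i
      induction i with
      | zero => exact hM
      | succ i ih =>
        intro n hn
        rw [yPowMul_succ, coeff_yMul, ih n (by omega), ih (n - 1) (by omega)]
        simp
    refine ⟨M + N, fun n hn => ?_⟩
    refine (eq_coeff_mul fun K => ?_).symm
    rw [Finset.sum_eq_zero]
    · simp
    · intro i _
      by_cases hi : i < N
      · rw [h i n (by omega), mul_zero]
      · rw [hN i (by omega), zero_mul]

end PowerSeries

end SkewDatum

/-! ### `α`-prime ideals -/

/-- `I` is an `α`-ideal: a two-sided ideal with `α(I) ⊆ I`. -/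
structure IsAlphaIdeal {A : Type*} [Ring A] (α : A →+* A) (I : Ideal A) : Prop where
  isTwoSided : I.IsTwoSided
  map_le : I ≤ I.comap α

/-- The ring `A` is `α`-prime: it is nonzero and the product of two nonzero `α`-ideals of `A` is
nonzero. -/
def IsAlphaPrimeRing {A : Type*} [Ring A] (α : A →+* A) : Prop :=
  Nontrivial A ∧ ∀ I J : Ideal A, IsAlphaIdeal α I → IsAlphaIdeal α J →
    I ≠ ⊥ → J ≠ ⊥ → I * J ≠ ⊥

/-- `P` is an `α`-prime ideal of `A`: a proper `α`-ideal such that `A / P` is an `α`-prime ring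
under the induced action of `α`. -/
def IsAlphaPrime {A : Type*} [Ring A] (α : A →+* A) (P : Ideal A) : Prop :=
  ∃ h : IsAlphaIdeal α P, P ≠ ⊤ ∧
    haveI := h.isTwoSided
    IsAlphaPrimeRing (Ideal.quotientMap P α h.map_le)

/-! ### `τ`-`δ`-prime ideals -/

/-- `I` is a `τ`-`δ`-ideal: a two-sided ideal with `τ(I) = I` and `δ(I) ⊆ I`. -/
structure IsTauDeltaIdeal {A : Type*} [Ring A] (τ : A →+* A) (δ : A →+ A) (I : Ideal A) :
    Prop where
  isTwoSided : I.IsTwoSided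
  image_eq : τ '' (I : Set A) = I
  δ_mem : ∀ a ∈ I, δ a ∈ I

theorem IsTauDeltaIdeal.map_le {A : Type*} [Ring A] {τ : A →+* A} {δ : A →+ A} {I : Ideal A}
    (h : IsTauDeltaIdeal τ δ I) : I ≤ I.comap τ := fun a ha => by
  have : τ a ∈ τ '' (I : Set A) := ⟨a, ha, rfl⟩
  rwa [h.image_eq] at this

/-- The ring `A` is `τ`-`δ`-prime: it is nonzero and the product of two nonzero `τ`-`δ`-ideals of
`A` is nonzero. -/
def IsTauDeltaPrimeRing {A : Type*} [Ring A] (τ : A →+* A) (δ : A →+ A) : Prop :=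
  Nontrivial A ∧ ∀ I J : Ideal A, IsTauDeltaIdeal τ δ I → IsTauDeltaIdeal τ δ J →
    I ≠ ⊥ → J ≠ ⊥ → I * J ≠ ⊥

/-- The additive map `a + I ↦ δ(a) + I` of `A / I` induced by an additive map `δ` of `A` with
`δ(I) ⊆ I`. -/
def quotientAddMap {A : Type*} [Ring A] (I : Ideal A) (δ : A →+ A) (h : ∀ a ∈ I, δ a ∈ I) :
    A ⧸ I →+ A ⧸ I :=
  QuotientAddGroup.map I.toAddSubgroup I.toAddSubgroup δ h

theorem quotientAddMap_mk {A : Type*} [Ring A] (I : Ideal A) (δ : A →+ A)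
    (h : ∀ a ∈ I, δ a ∈ I) (a : A) :
    quotientAddMap I δ h (Submodule.Quotient.mk a) = Submodule.Quotient.mk (δ a) := rfl

/-- `Q` is a `τ`-`δ`-prime ideal of `A`: a proper `τ`-`δ`-ideal such that `A / Q` is a
`τ`-`δ`-prime ring under the induced actions of `τ` and `δ`. -/
def IsTauDeltaPrime {A : Type*} [Ring A] (τ : A →+* A) (δ : A →+ A) (Q : Ideal A) : Prop :=
  ∃ h : IsTauDeltaIdeal τ δ Q, Q ≠ ⊤ ∧
    haveI := h.isTwoSided
    IsTauDeltaPrimeRing (Ideal.quotientMap Q τ h.map_le) (quotientAddMap Q δ h.δ_mem)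

/-! Both statements rest on comparing a `τ`-`δ`-ideal `J` of `R` with the ideal `J[[y]]` of `T`
(`coeffIdeal`). The multiplication of `T` involves infinite sums, while ideals of `T` are not known
to be closed and the extension `σ` of `τ` is not assumed continuous. Finite generation removes the
difficulty: since `gr R` is right noetherian, successive approximation along leading forms shows
that the closure of a two-sided ideal of `R` is generated by finitely many elements of that ideal as
a right ideal (`exists_right_generators`). Hence such ideals are closed, and every element of
`J[[y]]` is a finite sum `∑ g t` with `g ∈ J` and `t ∈ T` (`exists_eq_sum_of_mem_coeffIdeal`). So
`J[[y]]` is a `σ`-ideal, it lies in every two-sided ideal of `T` containing `J`, and `K L ⊆ J` gives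
`K[[y]] L[[y]] ⊆ J[[y]]`.

Conversely a `σ`-ideal of `T` contracts to a `τ`-`δ`-ideal (`isTauDeltaIdeal_comap`): `δ(a) = y a -
τ(a) y` gives `δ`-stability, and an ascending chain argument upgrades `τ(J) ⊆ J` to equality
(`τ_image_eq`).

Cutting down: if `I J ⊆ P ∩ R`, then `I[[y]] J[[y]] ⊆ P`, and primeness of `P` applies. Lying over:
`Q[[y]]` contracts to `Q`, so Zorn's lemma gives a `σ`-ideal maximal among those contracting to `Q`.
It is `σ`-prime, because two larger `σ`-ideals with product inside it have contractions whose
product lies in `Q`. -/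

/-! ### Ideals of `R` and the associated graded ring -/

section Generators

variable {R : Type*} [Ring R]

/-- The additive monoid `∑ x, g x * I ^ (n - d x)`, the sum running over the `x` with `d x ≤ n`. -/
def weightedSpan (I : Ideal R) {ι : Type*} [Fintype ι] (g : ι → R) (d : ι → ℕ) (n : ℕ) :
    AddSubmonoid R where
  carrier := {a | ∃ r : ι → R, (∀ x, r x ∈ I ^ (n - d x)) ∧ (∀ x, n < d x → r x = 0) ∧
    a = ∑ x, g x * r x}
  zero_mem' := ⟨0, fun _ => zero_mem _, fun _ _ => rfl, by simp⟩
  add_mem' := by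
    rintro _ _ ⟨r, hr, hr', rfl⟩ ⟨s, hs, hs', rfl⟩
    refine ⟨r + s, fun x => add_mem (hr x) (hs x), fun x hx => ?_, ?_⟩
    · simp [hr' x hx, hs' x hx]
    · simp [mul_add, Finset.sum_add_distrib]

variable {I : Ideal R} {ι : Type*} [Fintype ι] {g : ι → R} {d : ι → ℕ}

theorem self_mem_weightedSpan (x : ι) : g x ∈ weightedSpan I g d (d x) := by
  classical
  refine ⟨Pi.single x 1, fun z => ?_, fun z hz => ?_, ?_⟩
  · by_cases h : z = x
    · subst h; rw [Nat.sub_self]; exact GrPiece.mem_pow_zero _ _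
    · rw [Pi.single_eq_of_ne h]; exact zero_mem _
  · exact Pi.single_eq_of_ne (by rintro rfl; exact lt_irrefl _ hz) _
  · rw [Finset.sum_eq_single x]
    · simp
    · intro z _ hz; simp [Pi.single_eq_of_ne hz]
    · simp

variable [I.IsTwoSided]

theorem mul_mem_weightedSpan {m n : ℕ} {a b : R} (ha : a ∈ weightedSpan I g d m)
    (hb : b ∈ I ^ n) : a * b ∈ weightedSpan I g d (m + n) := by
  obtain ⟨r, hr, hr', rfl⟩ := ha
  refine ⟨fun x => r x * b, fun x => ?_, fun x hx => ?_, ?_⟩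
  · exact Ideal.pow_le_pow_right (by omega) (GrPiece.mul_mem_pow I (hr x) hb)
  · simp only [hr' x (by omega), zero_mul]
  · simp only [Finset.sum_mul, mul_assoc]

variable (I g d) in
/-- The additive monoid generated by the classes of the elements of the `weightedSpan I g d n`. -/
def weightedGraded : AddSubmonoid (AssocGraded I) :=
  AddSubmonoid.closure {z | ∃ n a, ∃ ha : a ∈ I ^ n, a ∈ weightedSpan I g d n ∧
    z = DirectSum.of (GrPiece I) n (GrPiece.mk I n a ha)}

theorem AssocGraded.mul_zero (z : AssocGraded I) : z * 0 = 0 :=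
  (inferInstance : Ring (AssocGraded I)).mul_zero z

theorem AssocGraded.zero_mul (z : AssocGraded I) : 0 * z = 0 :=
  (inferInstance : Ring (AssocGraded I)).zero_mul z

theorem AssocGraded.mul_add (z c c' : AssocGraded I) : z * (c + c') = z * c + z * c' :=
  (inferInstance : Ring (AssocGraded I)).left_distrib z c c'

theorem AssocGraded.add_mul (z z' c : AssocGraded I) : (z + z') * c = z * c + z' * c :=
  (inferInstance : Ring (AssocGraded I)).right_distrib z z' c

/-- Stability under right multiplication makes `weightedGraded I g d` a right ideal, so it contains
the right ideal generated by the leading forms of the `g x` once each `g x` lies in `I ^ d x`. -/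
theorem mul_mem_weightedGraded {z : AssocGraded I} (hz : z ∈ weightedGraded I g d)
    (c : AssocGraded I) : z * c ∈ weightedGraded I g d := by
  induction c using DirectSum.induction_on with
  | zero => rw [AssocGraded.mul_zero]; exact zero_mem _
  | add c c' h h' => rw [AssocGraded.mul_add]; exact add_mem h h'
  | of m b =>
    obtain ⟨b, hb, rfl⟩ := GrPiece.exists_mk I b
    induction hz using AddSubmonoid.closure_induction with
    | zero => rw [AssocGraded.zero_mul]; exact zero_mem _
    | add z z' _ _ h h' => rw [AssocGraded.add_mul]; exact add_mem h h'
    | mem z h =>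
      obtain ⟨n, a, ha, hs, rfl⟩ := h
      rw [DirectSum.of_mul_of]
      exact AddSubmonoid.subset_closure
        ⟨n + m, a * b, GrPiece.mul_mem_pow I ha hb, mul_mem_weightedSpan hs hb, rfl⟩

/-- This returns from `gr R` to `R`: a homogeneous component of an element of the right ideal lifts
to a combination of the `g x` whose coefficients have the expected order. -/
theorem apply_of_mem_weightedGraded {z : AssocGraded I} (hz : z ∈ weightedGraded I g d) (n : ℕ) :
    ∃ a, ∃ ha : a ∈ I ^ n, a ∈ weightedSpan I g d n ∧ z n = GrPiece.mk I n a ha := by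
  induction hz using AddSubmonoid.closure_induction with
  | zero => exact ⟨0, zero_mem _, zero_mem _, rfl⟩
  | add z z' _ _ h h' =>
    obtain ⟨a, ha, hs, e⟩ := h
    obtain ⟨a', ha', hs', e'⟩ := h'
    exact ⟨a + a', add_mem ha ha', add_mem hs hs', by
      rw [DirectSum.add_apply, e, e', GrPiece.mk_add]⟩
  | mem z h =>
    obtain ⟨m, a, ha, hs, rfl⟩ := h
    by_cases hmn : m = n
    · subst hmn
      exact ⟨a, ha, hs, DirectSum.of_eq_same _ _⟩
    · exact ⟨0, zero_mem _, zero_mem _, DirectSum.of_eq_of_ne _ _ _ (Ne.symm hmn)⟩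

/-- If the associated graded ring is right noetherian, then every ideal contains finitely many
elements whose leading forms generate the leading forms of all its elements. -/
theorem exists_leading_generators (I : Ideal R) [I.IsTwoSided]
    (hgr : IsNoetherianRing (AssocGraded I)ᵐᵒᵖ) (J : Ideal R) :
    ∃ (s : Finset (AssocGraded I)ᵐᵒᵖ) (g : s → R) (d : s → ℕ), (∀ x, g x ∈ J) ∧
      ∀ n, ∀ a ∈ J, a ∈ I ^ n → ∃ b ∈ weightedSpan I g d n, a - b ∈ I ^ (n + 1) := by
  set L : Set (AssocGraded I)ᵐᵒᵖ := {z | ∃ n a, ∃ ha : a ∈ I ^ n, a ∈ J ∧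
    z = MulOpposite.op (DirectSum.of (GrPiece I) n (GrPiece.mk I n a ha))} with hL
  -- The finite generating set is taken inside `L`, so each generator is the class, in some degree
  -- `d x`, of an actual element `g x` of `J`.
  obtain ⟨s, hsL, hs⟩ := (Submodule.fg_span_iff_fg_span_finset_subset L).1
    (IsNoetherian.noetherian (Submodule.span (AssocGraded I)ᵐᵒᵖ L))
  choose d g hg hJ e using fun x : s => hsL x.2
  refine ⟨s, g, d, hJ, fun n a ha han => ?_⟩
  have key : ∀ z ∈ Submodule.span (AssocGraded I)ᵐᵒᵖ (s : Set (AssocGraded I)ᵐᵒᵖ),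
      z.unop ∈ weightedGraded I g d := by
    intro z hz
    induction hz using Submodule.span_induction with
    | zero => exact zero_mem _
    | add z z' _ _ h h' => exact add_mem h h'
    -- Scalar multiplication over the opposite ring is right multiplication in `gr R`.
    | smul c z _ h => exact mul_mem_weightedGraded h c.unop
    | mem z h =>
      rw [show z = _ from e ⟨z, h⟩]
      exact AddSubmonoid.subset_closure ⟨_, _, hg _, self_mem_weightedSpan _, rfl⟩
  have hz : MulOpposite.op (DirectSum.of (GrPiece I) n (GrPiece.mk I n a han)) ∈
      Submodule.span (AssocGraded I)ᵐᵒᵖ (s : Set (AssocGraded I)ᵐᵒᵖ) := by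
    rw [← hs]
    exact Submodule.subset_span ⟨n, a, han, ha, rfl⟩
  obtain ⟨b, hb, hbs, eb⟩ := apply_of_mem_weightedGraded (key _ hz) n
  refine ⟨b, hbs, (GrPiece.mk_eq_mk I han hb).1 ?_⟩
  rw [← eb]
  exact (DirectSum.of_eq_same n (GrPiece.mk I n a han)).symm

end Generators

/-! ### Closedness and finite generation of the two-sided ideals of `R`. -/

namespace SkewDatum

variable {R : Type*} [Ring R] (D : SkewDatum R)

/-- The `D.i`-adic closure of an ideal is generated, as a right ideal, by finitely many elements of
the ideal. -/
theorem exists_right_generators (hgr : IsNoetherianRing (AssocGraded D.i)ᵐᵒᵖ) (J : Ideal R)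
    [J.IsTwoSided] : ∃ (s : Finset (AssocGraded D.i)ᵐᵒᵖ) (g : s → R), (∀ x, g x ∈ J) ∧
      ∀ a, (∀ k, ∃ b ∈ J, a - b ∈ D.i ^ k) → ∃ r : s → R, a = ∑ x, g x * r x := by
  obtain ⟨s, g, d, hJ, h⟩ := exists_leading_generators D.i hgr J
  refine ⟨s, g, hJ, fun a ha => ?_⟩
  -- One round of approximation: `c` agrees modulo `D.i ^ (n + 1)` with some `b ∈ J`, which then
  -- also lies in `D.i ^ n`, and the leading form of `b` is matched by the generators.
  have step : ∀ n c, (∀ k, ∃ b ∈ J, c - b ∈ D.i ^ k) → c ∈ D.i ^ n →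
      ∃ r : s → R, (∀ x, r x ∈ D.i ^ (n - d x)) ∧ c - ∑ x, g x * r x ∈ D.i ^ (n + 1) := by
    intro n c hc hcn
    obtain ⟨b, hb, hcb⟩ := hc (n + 1)
    have hbn : b ∈ D.i ^ n := by
      have := sub_mem hcn (Ideal.pow_le_pow_right (Nat.le_succ n) hcb)
      rwa [sub_sub_cancel] at this
    obtain ⟨_, ⟨r, hr, -, rfl⟩, hr'⟩ := h n b hb hbn
    refine ⟨r, hr, ?_⟩
    have := add_mem hcb hr'
    rwa [sub_add_sub_cancel] at this
  choose! ρ hρ hρ' using step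
  -- `u n` is the error left after `n` rounds. It stays in the closure of `J` because each
  -- correction lies in `J`, and it lies in `D.i ^ n`.
  let u : ℕ → R := fun n => Nat.rec a (fun n c => c - ∑ x, g x * ρ n c x) n
  have hu : ∀ n, u (n + 1) = u n - ∑ x, g x * ρ n (u n) x := fun _ => rfl
  have hmem : ∀ n, (∀ k, ∃ b ∈ J, u n - b ∈ D.i ^ k) ∧ u n ∈ D.i ^ n := by
    intro n
    induction n with
    | zero => exact ⟨ha, GrPiece.mem_pow_zero _ _⟩
    | succ n ih =>
      refine ⟨fun k => ?_, hρ' n _ ih.1 ih.2⟩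
      obtain ⟨b, hb, hb'⟩ := ih.1 k
      refine ⟨b - ∑ x, g x * ρ n (u n) x,
        sub_mem hb (sum_mem fun x _ => Ideal.mul_mem_right _ _ (hJ x)), ?_⟩
      rwa [hu, sub_sub_sub_cancel_right]
  have hsum : ∀ N, a - u N = ∑ x, g x * ∑ n ∈ Finset.range N, ρ n (u n) x := by
    intro N
    induction N with
    | zero => simp [u]
    | succ N ih =>
      simp only [Finset.sum_range_succ, mul_add, Finset.sum_add_distrib]
      rw [← ih, hu]
      abel
  have hmem' : ∀ x n, ρ n (u n) x ∈ D.i ^ (n - d x) := fun x n =>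
    hρ n _ (hmem n).1 (hmem n).2 x
  refine ⟨fun x => adicSum D.i fun n => ρ n (u n) x, D.eq_of_sub_mem fun k => ?_⟩
  -- Adding all the `d x` offsets every degree shift: `N - d x ≥ k`, so the tail from `N` of each
  -- coefficient series lies in `D.i ^ k`.
  set N := k + ∑ x, d x with hN
  have h1 : a - ∑ x, g x * ∑ n ∈ Finset.range N, ρ n (u n) x ∈ D.i ^ k := by
    rw [← hsum, sub_sub_cancel]
    exact Ideal.pow_le_pow_right (by omega) (hmem N).2
  have h2 : ∑ x, g x * (adicSum D.i fun n => ρ n (u n) x) -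
      ∑ x, g x * ∑ n ∈ Finset.range N, ρ n (u n) x ∈ D.i ^ k := by
    rw [← Finset.sum_sub_distrib]
    refine sum_mem fun x _ => ?_
    rw [← mul_sub]
    refine Ideal.mul_mem_left _ _ (Ideal.pow_le_pow_right ?_ (D.adicSum_sub_mem (hmem' x) N))
    have := Finset.single_le_sum (f := d) (fun _ _ => Nat.zero_le _) (Finset.mem_univ x)
    omega
  have := sub_mem h1 h2
  rwa [sub_sub_sub_cancel_right] at this

/-- Elements of the closure are finite combinations of generators lying in `J`, so two-sided ideals
are closed in the adic topology. -/
theorem mem_of_forall_exists_sub_mem (hgr : IsNoetherianRing (AssocGraded D.i)ᵐᵒᵖ) {J : Ideal R}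
    [J.IsTwoSided] {a : R} (ha : ∀ k, ∃ b ∈ J, a - b ∈ D.i ^ k) : a ∈ J := by
  obtain ⟨s, g, hg, h⟩ := D.exists_right_generators hgr J
  obtain ⟨r, rfl⟩ := h a ha
  exact sum_mem fun x _ => Ideal.mul_mem_right _ _ (hg x)

/-- An ideal that `τ` maps into itself is mapped onto itself. -/
theorem τ_image_eq (hgr : IsNoetherianRing (AssocGraded D.i)ᵐᵒᵖ) {J : Ideal R} [J.IsTwoSided]
    (hJ : ∀ a ∈ J, D.τ a ∈ J) : D.τ '' (J : Set R) = J := by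
  have mono : ∀ {m n : ℕ}, m ≤ n → ∀ {a}, D.τ^[m] a ∈ J → D.τ^[n] a ∈ J := by
    intro m n hmn a ha
    induction n, hmn using Nat.le_induction with
    | base => exact ha
    | succ n _ ih => rw [Function.iterate_succ_apply']; exact hJ _ ih
  have hadd : ∀ n a b, D.τ^[n] (a + b) = D.τ^[n] a + D.τ^[n] b := fun n =>
    iterate_map_add D.τ n
  have hmul : ∀ n a b, D.τ^[n] (a * b) = D.τ^[n] a * D.τ^[n] b := fun n =>
    iterate_map_mul D.τ n
  -- `U` is the union of the ascending chain of preimages of `J` under the powers of `τ`. Finitely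
  -- many right generators of `U` force the chain to stop.
  let U : Ideal R :=
    { carrier := {a | ∃ n, D.τ^[n] a ∈ J}
      zero_mem' := ⟨0, zero_mem J⟩
      add_mem' := by
        rintro a b ⟨m, hm⟩ ⟨n, hn⟩
        refine ⟨max m n, ?_⟩
        rw [hadd]
        exact add_mem (mono (le_max_left _ _) hm) (mono (le_max_right _ _) hn)
      smul_mem' := by
        rintro c a ⟨n, hn⟩
        exact ⟨n, by rw [smul_eq_mul, hmul]; exact Ideal.mul_mem_left _ _ hn⟩ }
  have : U.IsTwoSided := ⟨by
    rintro a b ⟨n, hn⟩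
    exact ⟨n, by rw [hmul]; exact Ideal.mul_mem_right _ _ hn⟩⟩
  obtain ⟨s, g, hg, h⟩ := D.exists_right_generators hgr U
  choose ν hν using hg
  have hU : ∀ a ∈ U, D.τ^[∑ x, ν x] a ∈ J := by
    intro a ha
    obtain ⟨r, rfl⟩ := h a fun k => ⟨a, ha, by rw [sub_self]; exact zero_mem _⟩
    have : D.τ^[∑ x, ν x] (∑ x, g x * r x) = ∑ x, D.τ^[∑ x, ν x] (g x * r x) := by
      exact map_sum (⟨⟨D.τ^[∑ x, ν x], iterate_map_zero D.τ _⟩, hadd _⟩ : R →+ R) _ _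
    rw [this]
    refine sum_mem fun x _ => ?_
    rw [hmul]
    exact Ideal.mul_mem_right _ _ (mono (Finset.single_le_sum (f := ν)
      (fun _ _ => Nat.zero_le _) (Finset.mem_univ x)) (hν x))
  refine Set.Subset.antisymm ?_ fun a ha => ?_
  · rintro _ ⟨a, ha, rfl⟩
    exact hJ a ha
  · obtain ⟨b, rfl⟩ := D.τ.surjective a
    obtain ⟨c, rfl⟩ := D.τ.surjective.iterate (∑ x, ν x) b
    -- With `N = ∑ x, ν x`, the given element is `τ^(N+1) c ∈ J`, so `c ∈ U`. Hence `τ^N c` already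
    -- lies in `J`, and it is the required preimage.
    refine ⟨_, hU c ⟨∑ x, ν x + 1, ?_⟩, rfl⟩
    rwa [Function.iterate_succ_apply']

/-! ### The ideals `J[[y]]` of `T` and contraction to `R`. -/

namespace PowerSeries

variable {D} {J : Ideal R}

theorem coeff_yPowMul_mem_of_forall (hτ : ∀ a ∈ J, D.τ a ∈ J) (hδ : ∀ a ∈ J, D.δ a ∈ J)
    {b : D.PowerSeries} (hb : ∀ n, coeff n b ∈ J) (i : ℕ) : ∀ n, coeff n (yPowMul i b) ∈ J := by
  induction i with
  | zero => exact hb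
  | succ i ih =>
    intro n
    rw [yPowMul_succ, coeff_yMul]
    refine add_mem ?_ (hδ _ (ih n))
    split_ifs
    · exact zero_mem _
    · exact hτ _ (ih _)

/-- The coefficient of a product is a limit of partial sums lying in `J`, and `J` is closed. -/
theorem coeff_mul_mem_of_terms (hgr : IsNoetherianRing (AssocGraded D.i)ᵐᵒᵖ) [J.IsTwoSided]
    {a b : D.PowerSeries} {n : ℕ} (h : ∀ i, coeff i a * coeff n (yPowMul i b) ∈ J) :
    coeff n (a * b) ∈ J :=
  D.mem_of_forall_exists_sub_mem hgr fun k =>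
    ⟨_, sum_mem fun i _ => h i, by simpa using coeff_mul_sub_mem a b n (k + n)⟩

/-- The left ideal `J[[y]]` of the series with coefficients in a `τ`-`δ`-ideal `J`. -/
def coeffIdeal (hgr : IsNoetherianRing (AssocGraded D.i)ᵐᵒᵖ) (J : Ideal R)
    (hJ : IsTauDeltaIdeal (D.τ : R →+* R) D.δ J) : Ideal D.PowerSeries where
  carrier := {a | ∀ n, coeff n a ∈ J}
  zero_mem' := fun _ => zero_mem J
  add_mem' := fun ha hb n => add_mem (ha n) (hb n)
  smul_mem' := fun _ _ ha n =>
    have := hJ.isTwoSided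
    coeff_mul_mem_of_terms hgr fun i => Ideal.mul_mem_left _ _
      (coeff_yPowMul_mem_of_forall hJ.map_le hJ.δ_mem ha i n)

variable {hgr : IsNoetherianRing (AssocGraded D.i)ᵐᵒᵖ}
  {hJ : IsTauDeltaIdeal (D.τ : R →+* R) D.δ J}

theorem mem_coeffIdeal {a : D.PowerSeries} : a ∈ coeffIdeal hgr J hJ ↔ ∀ n, coeff n a ∈ J :=
  Iff.rfl

instance : (coeffIdeal hgr J hJ).IsTwoSided :=
  ⟨fun _ ha _ =>
    have := hJ.isTwoSided
    coeff_mul_mem_of_terms hgr fun i => Ideal.mul_mem_right _ _ (ha i)⟩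

theorem C_mem_coeffIdeal {r : R} : C r ∈ coeffIdeal hgr J hJ ↔ r ∈ J := by
  refine ⟨fun h => by simpa [coeff_C] using h 0, fun h n => ?_⟩
  rw [coeff_C]
  split_ifs
  · exact h
  · exact zero_mem _

/-- `J[[y]]` is generated by `J` as a right ideal. -/
theorem exists_eq_sum_of_mem_coeffIdeal {a : D.PowerSeries} (ha : a ∈ coeffIdeal hgr J hJ) :
    ∃ (s : Finset (AssocGraded D.i)ᵐᵒᵖ) (g : s → R) (t : s → D.PowerSeries), (∀ x, g x ∈ J) ∧
      a = ∑ x, C (g x) * t x := by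
  have := hJ.isTwoSided
  obtain ⟨s, g, hg, h⟩ := D.exists_right_generators hgr J
  -- The same generators serve all coefficients of `a`, so the multipliers of each `g x` assemble
  -- into one power series `t x`. Left multiplication by a constant acts coefficientwise, so no
  -- convergence enters.
  choose r hr using fun n => h (coeff n a) fun k =>
    ⟨_, ha n, by rw [sub_self]; exact zero_mem _⟩
  refine ⟨s, g, fun x => mk fun n => r n x, hg, ?_⟩
  ext n
  have hsum : ∀ f : s → D.PowerSeries, coeff n (∑ x, f x) = ∑ x, coeff n (f x) := fun f =>
    map_sum (⟨⟨coeff n, rfl⟩, coeff_add n⟩ : D.PowerSeries →+ R) f Finset.univ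
  rw [hsum, hr n]
  exact Finset.sum_congr rfl fun x _ => (coeff_const_mul (g x) (mk fun n => r n x) n).symm

/-- Finite sums suffice here, so `P` need not be closed in any topology on `T`. -/
theorem coeffIdeal_le {P : Ideal D.PowerSeries} [P.IsTwoSided] (h : ∀ r ∈ J, C r ∈ P) :
    coeffIdeal hgr J hJ ≤ P := by
  intro a ha
  obtain ⟨s, g, t, hg, rfl⟩ := exists_eq_sum_of_mem_coeffIdeal ha
  exact sum_mem fun x _ => Ideal.mul_mem_right _ _ (h _ (hg x))

/-- A ring homomorphism passes through a finite sum `∑ C (g x) * t x`, so continuity of `σ` is not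
needed. -/
theorem isAlphaIdeal_coeffIdeal {σ : D.PowerSeries →+* D.PowerSeries}
    (hσ : ∀ r : R, σ (C r) = C (D.τ r)) : IsAlphaIdeal σ (coeffIdeal hgr J hJ) := by
  refine ⟨inferInstance, fun a ha => ?_⟩
  obtain ⟨s, g, t, hg, rfl⟩ := exists_eq_sum_of_mem_coeffIdeal ha
  rw [Ideal.mem_comap, map_sum]
  refine sum_mem fun x _ => ?_
  rw [map_mul, hσ]
  exact Ideal.mul_mem_right _ _ (C_mem_coeffIdeal.2 (hJ.map_le (hg x)))

/-- If `K L ⊆ J`, then `K[[y]] L[[y]] ⊆ J[[y]]`. -/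
theorem coeffIdeal_mul_le {K L : Ideal R} {hK : IsTauDeltaIdeal (D.τ : R →+* R) D.δ K}
    {hL : IsTauDeltaIdeal (D.τ : R →+* R) D.δ L} (h : K * L ≤ J) :
    coeffIdeal hgr K hK * coeffIdeal hgr L hL ≤ coeffIdeal hgr J hJ := by
  refine Ideal.mul_le.2 fun a ha b hb => ?_
  -- Only the left factor is expanded. Each `t x * b` remains in `L[[y]]`, and multiplying its
  -- coefficients on the left by `g x ∈ K` lands in `K * L`.
  obtain ⟨s, g, t, hg, rfl⟩ := exists_eq_sum_of_mem_coeffIdeal ha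
  rw [Finset.sum_mul]
  refine sum_mem fun x _ n => ?_
  rw [mul_assoc]
  rw [show coeff n (C (g x) * (t x * b)) = _ from coeff_const_mul (g x) (t x * b) n]
  exact h (Ideal.mul_mem_mul (hg x) ((coeffIdeal hgr L hL).mul_mem_left (t x) hb n))

/-- The contraction of a `σ`-ideal of `T` is a `τ`-`δ`-ideal of `R`. -/
theorem isTauDeltaIdeal_comap (hgr : IsNoetherianRing (AssocGraded D.i)ᵐᵒᵖ)
    {σ : D.PowerSeries →+* D.PowerSeries}
    (hσ : ∀ r : R, σ (C r) = C (D.τ r)) {P : Ideal D.PowerSeries} (hP : IsAlphaIdeal σ P) :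
    IsTauDeltaIdeal (D.τ : R →+* R) D.δ (P.comap (C : R →+* D.PowerSeries)) := by
  have := hP.isTwoSided
  have : (P.comap (C : R →+* D.PowerSeries)).IsTwoSided := inferInstance
  refine ⟨this, D.τ_image_eq hgr fun a ha => ?_, fun a ha => ?_⟩
  · have := hP.map_le ha
    rwa [Ideal.mem_comap, hσ] at this
  -- `δ(a)` is recovered as `y a - τ(a) y`, both terms of which lie in `P`.
  · have h1 : (y : D.PowerSeries) * C a ∈ P := P.mul_mem_left _ ha
    have h2 : C (D.τ a) * (y : D.PowerSeries) ∈ P := by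
      refine Ideal.mul_mem_right _ _ ?_
      have := hP.map_le ha
      rwa [Ideal.mem_comap, hσ] at this
    have := sub_mem h1 h2
    rwa [y_mul_C, add_sub_cancel_left] at this

end PowerSeries

end SkewDatum

/-! ### Primeness in terms of ideals containing the given one -/

section Prime

variable {A : Type*} [Ring A] {P : Ideal A} [P.IsTwoSided]

theorem map_mk_ne_bot {I : Ideal A} (h : ¬ I ≤ P) : I.map (Ideal.Quotient.mk P) ≠ ⊥ := by
  intro e
  refine h fun a ha => ?_
  have := Ideal.mem_map_of_mem (Ideal.Quotient.mk P) ha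
  rw [e] at this
  exact Ideal.Quotient.eq_zero_iff_mem.1 ((Submodule.mem_bot _).1 this)

theorem map_mk_mul_eq_bot {I J : Ideal A} (h : I * J ≤ P) :
    I.map (Ideal.Quotient.mk P) * J.map (Ideal.Quotient.mk P) = ⊥ := by
  refine le_bot_iff.1 (Ideal.mul_le.2 fun x hx z hz => ?_)
  obtain ⟨a, ha, rfl⟩ := (Ideal.mem_map_iff_of_surjective _ Ideal.Quotient.mk_surjective).1 hx
  obtain ⟨b, hb, rfl⟩ := (Ideal.mem_map_iff_of_surjective _ Ideal.Quotient.mk_surjective).1 hz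
  rw [← map_mul, Ideal.Quotient.eq_zero_iff_mem.2 (h (Ideal.mul_mem_mul ha hb))]
  exact zero_mem _

theorem comap_mk_mul_le {I J : Ideal (A ⧸ P)} (h : I * J = ⊥) :
    I.comap (Ideal.Quotient.mk P) * J.comap (Ideal.Quotient.mk P) ≤ P := by
  refine Ideal.mul_le.2 fun a ha b hb => Ideal.Quotient.eq_zero_iff_mem.1 ?_
  have := Ideal.mul_mem_mul (Ideal.mem_comap.1 ha) (Ideal.mem_comap.1 hb)
  rw [h] at this
  rw [map_mul]
  exact (Submodule.mem_bot _).1 this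

theorem le_comap_mk (I : Ideal (A ⧸ P)) : P ≤ I.comap (Ideal.Quotient.mk P) := fun a ha => by
  rw [Ideal.mem_comap, Ideal.Quotient.eq_zero_iff_mem.2 ha]
  exact zero_mem _

theorem not_comap_mk_le {I : Ideal (A ⧸ P)} (h : I ≠ ⊥) :
    ¬ I.comap (Ideal.Quotient.mk P) ≤ P := by
  intro h'
  refine h (le_bot_iff.1 fun x hx => ?_)
  obtain ⟨a, rfl⟩ := Ideal.Quotient.mk_surjective x
  exact (Submodule.mem_bot _).2 (Ideal.Quotient.eq_zero_iff_mem.2 (h' hx))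

theorem isTwoSided_map_mk (I : Ideal A) [I.IsTwoSided] :
    (I.map (Ideal.Quotient.mk P)).IsTwoSided := by
  refine ⟨fun z hx => ?_⟩
  obtain ⟨a, ha, rfl⟩ := (Ideal.mem_map_iff_of_surjective _ Ideal.Quotient.mk_surjective).1 hx
  obtain ⟨b, rfl⟩ := Ideal.Quotient.mk_surjective z
  rw [← map_mul]
  exact Ideal.mem_map_of_mem _ (Ideal.mul_mem_right _ _ ha)

end Prime

section AlphaPrime

variable {A : Type*} [Ring A] {α : A →+* A} {P : Ideal A}

theorem IsAlphaPrime.le_or_le (hP : IsAlphaPrime α P) {I J : Ideal A} (hI : IsAlphaIdeal α I)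
    (hJ : IsAlphaIdeal α J) (h : I * J ≤ P) : I ≤ P ∨ J ≤ P := by
  obtain ⟨hα, -, -, hp⟩ := hP
  have := hα.isTwoSided
  have key : ∀ {K : Ideal A}, IsAlphaIdeal α K → IsAlphaIdeal (Ideal.quotientMap P α hα.map_le)
      (K.map (Ideal.Quotient.mk P)) := by
    intro K hK
    have := hK.isTwoSided
    refine ⟨isTwoSided_map_mk K, fun x hx => ?_⟩
    obtain ⟨a, ha, rfl⟩ := (Ideal.mem_map_iff_of_surjective _ Ideal.Quotient.mk_surjective).1 hx
    exact Ideal.mem_map_of_mem _ (hK.map_le ha)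
  by_contra! hc
  exact hp _ _ (key hI) (key hJ) (map_mk_ne_bot hc.1) (map_mk_ne_bot hc.2) (map_mk_mul_eq_bot h)

/-- Ideals of `A ⧸ P` pull back to ideals containing `P`, so only those need testing. This
restriction is what lets a maximality argument apply. -/
theorem IsAlphaPrime.of_mul_le (hα : IsAlphaIdeal α P) (hP : P ≠ ⊤)
    (h : ∀ I J : Ideal A, IsAlphaIdeal α I → IsAlphaIdeal α J → P ≤ I → P ≤ J → I * J ≤ P →
      I ≤ P ∨ J ≤ P) : IsAlphaPrime α P := by
  have := hα.isTwoSided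
  have key : ∀ {K : Ideal (A ⧸ P)}, IsAlphaIdeal (Ideal.quotientMap P α hα.map_le) K →
      IsAlphaIdeal α (K.comap (Ideal.Quotient.mk P)) := by
    intro K hK
    have := hK.isTwoSided
    exact ⟨inferInstance, fun a ha => hK.map_le (Ideal.mem_comap.1 ha)⟩
  refine ⟨hα, hP, Ideal.Quotient.nontrivial_iff.2 hP, fun I J hI hJ hI0 hJ0 hIJ => ?_⟩
  rcases h _ _ (key hI) (key hJ) (le_comap_mk I) (le_comap_mk J) (comap_mk_mul_le hIJ) with h' | h'
  · exact not_comap_mk_le hI0 h'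
  · exact not_comap_mk_le hJ0 h'

end AlphaPrime

section TauDeltaPrime

variable {A : Type*} [Ring A] {τ : A →+* A} {δ : A →+ A} {Q : Ideal A}

theorem IsTauDeltaPrime.le_or_le (hQ : IsTauDeltaPrime τ δ Q) {I J : Ideal A}
    (hI : IsTauDeltaIdeal τ δ I) (hJ : IsTauDeltaIdeal τ δ J) (h : I * J ≤ Q) :
    I ≤ Q ∨ J ≤ Q := by
  obtain ⟨hτ, -, -, hp⟩ := hQ
  have := hτ.isTwoSided
  have key : ∀ {K : Ideal A}, IsTauDeltaIdeal τ δ K →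
      IsTauDeltaIdeal (Ideal.quotientMap Q τ hτ.map_le) (quotientAddMap Q δ hτ.δ_mem)
        (K.map (Ideal.Quotient.mk Q)) := by
    intro K hK
    have := hK.isTwoSided
    refine ⟨isTwoSided_map_mk K, Set.Subset.antisymm ?_ fun x hx => ?_, fun x hx => ?_⟩
    · rintro _ ⟨x, hx, rfl⟩
      obtain ⟨a, ha, rfl⟩ := (Ideal.mem_map_iff_of_surjective _ Ideal.Quotient.mk_surjective).1 hx
      exact Ideal.mem_map_of_mem _ (hK.map_le ha)
    · obtain ⟨a, ha, rfl⟩ := (Ideal.mem_map_iff_of_surjective _ Ideal.Quotient.mk_surjective).1 hx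
      rw [← SetLike.mem_coe, ← hK.image_eq] at ha
      obtain ⟨b, hb, rfl⟩ := ha
      exact ⟨_, Ideal.mem_map_of_mem _ hb, rfl⟩
    · obtain ⟨a, ha, rfl⟩ := (Ideal.mem_map_iff_of_surjective _ Ideal.Quotient.mk_surjective).1 hx
      exact Ideal.mem_map_of_mem (Ideal.Quotient.mk Q) (hK.δ_mem a ha)
  by_contra! hc
  exact hp _ _ (key hI) (key hJ) (map_mk_ne_bot hc.1) (map_mk_ne_bot hc.2) (map_mk_mul_eq_bot h)

theorem IsTauDeltaPrime.of_mul_le (hτ : IsTauDeltaIdeal τ δ Q) (hQ : Q ≠ ⊤)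
    (h : ∀ I J : Ideal A, IsTauDeltaIdeal τ δ I → IsTauDeltaIdeal τ δ J → I * J ≤ Q →
      I ≤ Q ∨ J ≤ Q) : IsTauDeltaPrime τ δ Q := by
  have := hτ.isTwoSided
  have key : ∀ {K : Ideal (A ⧸ Q)}, IsTauDeltaIdeal (Ideal.quotientMap Q τ hτ.map_le)
      (quotientAddMap Q δ hτ.δ_mem) K → IsTauDeltaIdeal τ δ (K.comap (Ideal.Quotient.mk Q)) := by
    intro K hK
    have := hK.isTwoSided
    refine ⟨inferInstance, Set.Subset.antisymm ?_ fun a ha => ?_, fun a ha => ?_⟩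
    · rintro _ ⟨a, ha, rfl⟩
      exact hK.map_le (Ideal.mem_comap.1 ha)
    · have ha' : Ideal.Quotient.mk Q a ∈ (K : Set (A ⧸ Q)) := ha
      rw [← hK.image_eq] at ha'
      obtain ⟨x, hx, e⟩ := ha'
      obtain ⟨b, rfl⟩ := Ideal.Quotient.mk_surjective x
      -- The class of `a` is the image of that of `b`, so `a - τ b ∈ Q`. Since `τ(Q) = Q`, this
      -- difference is `τ c` with `c ∈ Q`, and `b + c` is an exact preimage of `a`.
      rw [Ideal.quotientMap_mk, Ideal.Quotient.eq, ← neg_mem_iff, neg_sub, ← SetLike.mem_coe,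
        ← hτ.image_eq] at e
      obtain ⟨c, hc, e⟩ := e
      refine ⟨b + c, add_mem hx (le_comap_mk K hc), ?_⟩
      rw [map_add, e, add_sub_cancel]
    · exact hK.δ_mem _ (Ideal.mem_comap.1 ha)
  refine ⟨hτ, hQ, Ideal.Quotient.nontrivial_iff.2 hQ, fun I J hI hJ hI0 hJ0 hIJ => ?_⟩
  rcases h _ _ (key hI) (key hJ) (comap_mk_mul_le hIJ) with h' | h'
  · exact not_comap_mk_le hI0 h'
  · exact not_comap_mk_le hJ0 h'

end TauDeltaPrime

/-! ### Lying over and cutting down. -/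

namespace SkewDatum.PowerSeries

variable {R : Type*} [Ring R] {D : SkewDatum R} {σ : D.PowerSeries →+* D.PowerSeries}

/-- A nonempty chain of `σ`-ideals with contraction `Q` has an upper bound of the same kind. -/
theorem exists_upper_bound_of_chain {Q : Ideal R} {c : Set (Ideal D.PowerSeries)}
    (hc : ∀ P ∈ c, IsAlphaIdeal σ P ∧ P.comap (C : R →+* D.PowerSeries) = Q)
    (hchain : IsChain (· ≤ ·) c) (hne : c.Nonempty) :
    ∃ U : Ideal D.PowerSeries, (IsAlphaIdeal σ U ∧ U.comap (C : R →+* D.PowerSeries) = Q) ∧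
      ∀ P ∈ c, P ≤ U := by
  have hmem : ∀ {x}, x ∈ sSup c ↔ ∃ P ∈ c, x ∈ P := fun {x} =>
    Submodule.mem_sSup_of_directed hne hchain.directedOn
  refine ⟨sSup c, ⟨⟨⟨fun b ha => ?_⟩, fun a ha => ?_⟩, ?_⟩, fun P hP => le_sSup hP⟩
  · obtain ⟨P, hP, ha⟩ := hmem.1 ha
    have := (hc P hP).1.isTwoSided
    exact hmem.2 ⟨P, hP, Ideal.mul_mem_right _ _ ha⟩
  · obtain ⟨P, hP, ha⟩ := hmem.1 ha
    exact hmem.2 ⟨P, hP, (hc P hP).1.map_le ha⟩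
  · ext r
    rw [Ideal.mem_comap, hmem]
    constructor
    · rintro ⟨P, hP, hr⟩
      rw [← (hc P hP).2]
      exact hr
    · intro hr
      obtain ⟨P, hP⟩ := hne
      rw [← (hc P hP).2] at hr
      exact ⟨P, hP, hr⟩

/-- Lying over: a `σ`-ideal that is maximal with contraction `Q` is `σ`-prime. -/
theorem exists_isAlphaPrime_comap_eq (hgr : IsNoetherianRing (AssocGraded D.i)ᵐᵒᵖ)
    (hσ : ∀ r : R, σ (C r) = C (D.τ r)) {Q : Ideal R}
    (hQ : IsTauDeltaPrime (D.τ : R →+* R) D.δ Q) :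
    ∃ P : Ideal D.PowerSeries, IsAlphaPrime σ P ∧ P.comap (C : R →+* D.PowerSeries) = Q := by
  obtain ⟨hQ', hQtop, -⟩ := id hQ
  obtain ⟨P, -, hP⟩ := zorn_le_nonempty₀
    {P : Ideal D.PowerSeries | IsAlphaIdeal σ P ∧ P.comap (C : R →+* D.PowerSeries) = Q}
    (fun c hc hchain P hP => exists_upper_bound_of_chain hc hchain ⟨P, hP⟩)
    (coeffIdeal hgr Q hQ') ⟨isAlphaIdeal_coeffIdeal hσ, Ideal.ext fun _ => C_mem_coeffIdeal (hgr := hgr) (hJ := hQ')⟩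
  obtain ⟨hPσ, hPQ⟩ := hP.prop
  refine ⟨P, IsAlphaPrime.of_mul_le hPσ ?_ fun I J hI hJ hPI hPJ hIJ => ?_, hPQ⟩
  · rintro rfl
    exact hQtop (hPQ.symm.trans Ideal.comap_top)
  -- Maximality of `P`: a `σ`-ideal above `P` whose contraction does not exceed `Q` contracts
  -- exactly to `Q`, hence is contained in `P`.
  · have key : ∀ {K : Ideal D.PowerSeries}, IsAlphaIdeal σ K → P ≤ K →
        K.comap (C : R →+* D.PowerSeries) ≤ Q → K ≤ P := fun hK hPK hKQ =>
      hP.le_of_ge ⟨hK, le_antisymm hKQ (hPQ ▸ Ideal.comap_mono hPK)⟩ hPK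
    refine (hQ.le_or_le (isTauDeltaIdeal_comap hgr hσ hI) (isTauDeltaIdeal_comap hgr hσ hJ)
      ?_).imp (key hI hPI) (key hJ hPJ)
    refine Ideal.mul_le.2 fun a ha b hb => ?_
    rw [← hPQ, Ideal.mem_comap, map_mul]
    exact hIJ (Ideal.mul_mem_mul ha hb)

/-- Cutting down: the contraction of a `σ`-prime ideal is `τ`-`δ`-prime. -/
theorem isTauDeltaPrime_comap (hgr : IsNoetherianRing (AssocGraded D.i)ᵐᵒᵖ)
    (hσ : ∀ r : R, σ (C r) = C (D.τ r)) {P : Ideal D.PowerSeries} (hP : IsAlphaPrime σ P) :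
    IsTauDeltaPrime (D.τ : R →+* R) D.δ (P.comap (C : R →+* D.PowerSeries)) := by
  obtain ⟨hPσ, hPtop, -⟩ := id hP
  have := hPσ.isTwoSided
  have hQ := isTauDeltaIdeal_comap hgr hσ hPσ
  refine IsTauDeltaPrime.of_mul_le hQ ?_ fun I J hI hJ hIJ => ?_
  · rw [Ne, Ideal.eq_top_iff_one, Ideal.mem_comap, map_one, ← Ideal.eq_top_iff_one]
    exact hPtop
  -- The product lies in `(P ∩ R)[[y]]`, which is contained in `P` because it is generated by `P ∩
  -- R` as a right ideal.
  · have hle : coeffIdeal hgr I hI * coeffIdeal hgr J hJ ≤ P :=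
      (coeffIdeal_mul_le (hJ := hQ) hIJ).trans (coeffIdeal_le fun _ hr => hr)
    exact (hP.le_or_le (isAlphaIdeal_coeffIdeal hσ) (isAlphaIdeal_coeffIdeal hσ) hle).imp
      (fun h _ hr => h (C_mem_coeffIdeal.2 hr)) (fun h _ hr => h (C_mem_coeffIdeal.2 hr))

end SkewDatum.PowerSeries

theorem mainTheorem1 {R : Type*} [Ring R] (D : SkewDatum R)
    (hgr : IsTwoSidedNoetherian (AssocGraded D.i))
    (σ : D.PowerSeries ≃+* D.PowerSeries)
    (hσR : ∀ r : R, σ (SkewDatum.PowerSeries.C r) = SkewDatum.PowerSeries.C (D.τ r))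
    (hσS : (SkewDatum.PowerSeries.skewPolynomials D).map (σ : D.PowerSeries →+* D.PowerSeries) =
      SkewDatum.PowerSeries.skewPolynomials D) :
    (∀ Q : Ideal R, IsTauDeltaPrime (D.τ : R →+* R) D.δ Q →
      ∃ P : Ideal D.PowerSeries,
        IsAlphaPrime (σ : D.PowerSeries →+* D.PowerSeries) P ∧
        P.comap (SkewDatum.PowerSeries.C : R →+* D.PowerSeries) = Q) ∧
    (∀ P : Ideal D.PowerSeries,
      IsAlphaPrime (σ : D.PowerSeries →+* D.PowerSeries) P →
        IsTauDeltaPrime (D.τ : R →+* R) D.δ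
          (P.comap (SkewDatum.PowerSeries.C : R →+* D.PowerSeries))) := by
  exact ⟨fun _ hQ => SkewDatum.PowerSeries.exists_isAlphaPrime_comap_eq hgr.2 hσR hQ,
    fun _ hP => SkewDatum.PowerSeries.isTauDeltaPrime_comap hgr.2 hσR hP⟩
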